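/- Let $A$ be a commutative unital $\mathbb{R}$-algebra and let $\tau$ be a locally multiplicatively convex topology on $A$, i.e. a locally convex vector space topology (not necessarily Hausdorff) that has a system of neighbourhoods of $0$ consisting of sets $V$ with $V\cdot V\subseteq V$. Let $d\ge 1$ be an integer, and let $\sum A^{2d}$ be the set of all finite sums of $2d$-th powers of elements of $A$. A $\sum A^{2d}$-module of $A$ is a subset $S\subseteq A$ with $1\in S$, $S+S\subseteq S$ and $a^{2d}\cdot S\subseteq S$ for every $a\in A$. Let $\mathcal{X}(A)$ be the set of all unital $\mathbb{R}$-algebra homomorphisms $A\to\mathbb{R}$, let $M_\tau\subseteq\mathcal{X}(A)$ be the set of those that are $\tau$-continuous, and for $S\subseteq A$ and $K\subseteq\mathcal{X}(A)$ put $$K_S=\{\alpha\in\mathcal{X}(A):\alpha(s)\ge 0\text{ for all }s\in S\},\qquad \mathrm{Pos}(K)=\{a\in A:\alpha(a)\ge 0\text{ for all }\alpha\in K\}.$$ Then for every $\sum A^{2d}$-module $S$ of $A$, the $\tau$-closure of $S$ is $$\overline{S}^{\tau}=\mathrm{Pos}(K_S\cap M_\tau).$$ In particular, $\overline{\sum A^{2d}}^{\tau}=\mathrm{Pos}(M_\tau)$.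 -/

import Mathlib

open Topology

/-- A topology on a commutative unital `ℝ`-algebra `A` is locally multiplicatively convex (lmc) if
it is a locally convex vector space topology (not necessarily Hausdorff) that has a system of
neighbourhoods of `0` consisting of `m`-sets, i.e. of sets `V` with `V * V ⊆ V`. -/
structure IsLMC (A : Type*) [CommRing A] [Algebra ℝ A] [TopologicalSpace A] : Prop where
  isTopologicalAddGroup : IsTopologicalAddGroup A
  continuousSMul : ContinuousSMul ℝ A
  locallyConvexSpace : LocallyConvexSpace ℝ A
  exists_mset : ∀ U ∈ 𝓝 (0 : A), ∃ V ∈ 𝓝 (0 : A), V ⊆ U ∧ ∀ x ∈ V, ∀ y ∈ V, x * y ∈ V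

/-- `∑ A^{2d}`: the set of all finite sums of `2d`-th powers of elements of `A`. -/
def sumEvenPowers (A : Type*) [CommRing A] (d : ℕ) : Set A :=
  {a | ∃ (n : ℕ) (f : Fin n → A), a = ∑ i, f i ^ (2 * d)}

/-- `S` is a `∑ A^{2d}`-module of `A`: `1 ∈ S`, `S + S ⊆ S` and `a^{2d} • S ⊆ S` for all `a`. -/
structure IsSumEvenPowersModule {A : Type*} [CommRing A] (d : ℕ) (S : Set A) : Prop where
  one_mem : (1 : A) ∈ S
  add_mem : ∀ s ∈ S, ∀ t ∈ S, s + t ∈ S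
  pow_mul_mem : ∀ a : A, ∀ s ∈ S, a ^ (2 * d) * s ∈ S

/-- `K_S`: the unital `ℝ`-algebra homomorphisms `A → ℝ` that are nonnegative on `S`. -/
def nonnegCharacters {A : Type*} [CommRing A] [Algebra ℝ A] (S : Set A) : Set (A →ₐ[ℝ] ℝ) :=
  {α | ∀ a ∈ S, 0 ≤ α a}

/-- `Pos(K)`: the elements of `A` that are nonnegative at every character in `K`. -/
def posCone {A : Type*} [CommRing A] [Algebra ℝ A] (K : Set (A →ₐ[ℝ] ℝ)) : Set A :=
  {a | ∀ α ∈ K, 0 ≤ α a}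

/-- The Gelfand spectrum `M_τ`: the continuous unital `ℝ`-algebra homomorphisms `A → ℝ`. -/
def gelfandSpectrum (A : Type*) [CommRing A] [Algebra ℝ A] [TopologicalSpace A] :
    Set (A →ₐ[ℝ] ℝ) :=
  {α | Continuous α}

theorem range_pow_mem_nhds_one (B : Type*) [NormedCommRing B] [NormedAlgebra ℝ B]
    [CompleteSpace B] {n : ℕ} (hn : n ≠ 0) : Set.range (fun y : B => y ^ n) ∈ 𝓝 (1 : B) := by
  let e : B ≃L[ℝ] B :=
    ContinuousLinearEquiv.smulLeft (Units.mk0 (n : ℝ) (by exact_mod_cast hn))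
  have hd : HasStrictFDerivAt (fun y : B => y ^ n) (e : B →L[ℝ] B) 1 := by
    convert hasStrictFDerivAt_pow (𝕜 := ℝ) (𝔸 := B) n (x := 1) using 1
    ext y
    simp [e, Units.smul_def, Nat.cast_smul_eq_nsmul]
  have h := Filter.range_mem_map (f := 𝓝 (1 : B)) (m := fun y : B => y ^ n)
  rwa [hd.map_nhds_eq_of_equiv, one_pow] at h

open Set UniformSpace in
theorem exists_pow_near_one_add (A : Type*) [SeminormedCommRing A] [NormedAlgebra ℝ A]
    (n : ℕ) (hn : n ≠ 0) :
    ∃ δ > 0, ∀ x : A, ‖x‖ < δ → ∀ ε > 0, ∃ y : A, ‖y ^ n - (1 + x)‖ < ε := by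
  let B := Completion A
  have hr : range (fun y : B => y ^ n) ∈ 𝓝 (1 : B) := range_pow_mem_nhds_one B hn
  obtain ⟨δ, hδ, hball⟩ := Metric.mem_nhds_iff.1 hr
  refine ⟨δ, hδ, fun x hx ε hε => ?_⟩
  have hx' : (1 + (x : B)) ∈ Metric.ball (1 : B) δ := by
    simpa [Metric.mem_ball, dist_eq_norm] using hx
  obtain ⟨z, hz⟩ := hball hx'
  have hz' : z ^ n = 1 + (x : B) := hz
  have hopen : IsOpen {w : B | ‖w ^ n - (1 + (x : B))‖ < ε} :=
    isOpen_lt (by fun_prop) continuous_const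
  obtain ⟨y, hy⟩ := Completion.denseRange_coe.exists_mem_open hopen
    ⟨z, by change ‖z ^ n - (1 + (x : B))‖ < ε; simpa [hz'] using hε⟩
  replace hy : ‖(y : B) ^ n - (1 + (x : B))‖ < ε := hy
  refine ⟨y, ?_⟩
  rw [← Completion.norm_coe]
  have hpow : ((y ^ n : A) : B) = (y : B) ^ n := map_pow (Completion.coeRingHom (α := A)) y n
  rwa [Completion.coe_sub, Completion.coe_add, Completion.coe_one, hpow]

section Functionals

variable {A : Type*} [SeminormedCommRing A] [NormedAlgebra ℝ A]

/-- If every `1 + x` with `‖x‖ < δ` is a limit of `2d`-th powers, then bounded functionals that are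
nonnegative on a module are nonnegative on the multiples of its elements by `1 + x`. -/
theorem nonneg_one_add_mul {d : ℕ} {S : Set A} (hS : IsSumEvenPowersModule d S) {δ : ℝ}
    (hδ : ∀ x : A, ‖x‖ < δ → ∀ ε > 0, ∃ y : A, ‖y ^ (2 * d) - (1 + x)‖ < ε)
    {f : A →ₗ[ℝ] ℝ} {C : ℝ} (hf : ∀ x, |f x| ≤ C * ‖x‖) (hfS : ∀ s ∈ S, 0 ≤ f s)
    {x s : A} (hx : ‖x‖ < δ) (hs : s ∈ S) : 0 ≤ f ((1 + x) * s) := by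
  by_contra! hneg
  set M : ℝ := (|C| + 1) * (‖s‖ + 1) with hM
  have hMpos : 0 < M := by positivity
  obtain ⟨y, hy⟩ := hδ x hx (-f ((1 + x) * s) / M) (div_pos (by linarith) hMpos)
  have h1 := hfS _ (hS.pow_mul_mem y s hs)
  have h2 : f (y ^ (2 * d) * s) - f ((1 + x) * s) = f ((y ^ (2 * d) - (1 + x)) * s) := by
    rw [← map_sub, sub_mul]
  have h3 : |f ((y ^ (2 * d) - (1 + x)) * s)| ≤ M * ‖y ^ (2 * d) - (1 + x)‖ := by
    refine (hf _).trans ?_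
    calc C * ‖(y ^ (2 * d) - (1 + x)) * s‖
        ≤ (|C| + 1) * (‖y ^ (2 * d) - (1 + x)‖ * (‖s‖ + 1)) := by
          refine mul_le_mul (by linarith [le_abs_self C]) ?_ (norm_nonneg _) (by positivity)
          refine (norm_mul_le _ _).trans ?_
          gcongr
          linarith
      _ = _ := by rw [hM]; ring
  rw [lt_div_iff₀ hMpos] at hy
  have h4 := le_abs_self (f ((y ^ (2 * d) - (1 + x)) * s))
  linarith

theorem abs_le_of_nonneg_on_module {d : ℕ} {S : Set A} (hS : IsSumEvenPowersModule d S) {δ : ℝ}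
    (hδ0 : 0 < δ)
    (hδ : ∀ x : A, ‖x‖ < δ → ∀ ε > 0, ∃ y : A, ‖y ^ (2 * d) - (1 + x)‖ < ε)
    {f : A →ₗ[ℝ] ℝ} {C : ℝ} (hf : ∀ x, |f x| ≤ C * ‖x‖) (hfS : ∀ s ∈ S, 0 ≤ f s) (x : A) :
    |f x| ≤ f 1 / δ * ‖x‖ := by
  have small : ∀ z : A, ‖z‖ < δ → |f z| ≤ f 1 := by
    intro z hz
    have h1 := nonneg_one_add_mul hS hδ hf hfS hz hS.one_mem
    have h2 := nonneg_one_add_mul hS hδ hf hfS (x := -z) (by rwa [norm_neg]) hS.one_mem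
    simp only [mul_one, map_add, map_neg] at h1 h2
    exact abs_le.2 ⟨by linarith, by linarith⟩
  have h1 := hfS 1 hS.one_mem
  have key : ∀ t > ‖x‖, |f x| ≤ f 1 / δ * t := by
    intro t ht
    have ht0 : 0 < t := (norm_nonneg x).trans_lt ht
    have h := small ((δ / t) • x) (by
      rw [norm_smul, Real.norm_of_nonneg (by positivity), div_mul_eq_mul_div, div_lt_iff₀ ht0]
      gcongr)
    rw [map_smul, smul_eq_mul, abs_mul, abs_of_pos (by positivity : 0 < δ / t)] at h
    rw [div_mul_eq_mul_div, div_le_iff₀ ht0] at h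
    rw [div_mul_eq_mul_div, le_div_iff₀ hδ0]
    linarith
  have hcont : Filter.Tendsto (fun t : ℝ => f 1 / δ * t) (𝓝[>] ‖x‖) (𝓝 (f 1 / δ * ‖x‖)) :=
    ((continuous_const.mul continuous_id).tendsto _).mono_left nhdsWithin_le_nhds
  exact ge_of_tendsto hcont (Filter.eventually_of_mem self_mem_nhdsWithin key)

/-- The linear functionals normalized at `1`, nonnegative on `S` and bounded by `C`. -/
def boundedStates (S : Set A) (C : ℝ) : Set (A → ℝ) :=
  {f | (∀ x y, f (x + y) = f x + f y) ∧ (∀ (r : ℝ) x, f (r • x) = r * f x) ∧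
    (∀ s ∈ S, 0 ≤ f s) ∧ f 1 = 1 ∧ ∀ x, |f x| ≤ C * ‖x‖}

/-- The linear map underlying an element of `boundedStates`. -/
def boundedStates.toLinearMap {S : Set A} {C : ℝ} {f : A → ℝ} (hf : f ∈ boundedStates S C) :
    A →ₗ[ℝ] ℝ where
  toFun := f
  map_add' := hf.1
  map_smul' := hf.2.1

theorem linearMap_mem_boundedStates {S : Set A} {C : ℝ} {f : A →ₗ[ℝ] ℝ}
    (hS : ∀ s ∈ S, 0 ≤ f s) (h1 : f 1 = 1) (hC : ∀ x, |f x| ≤ C * ‖x‖) :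
    (f : A → ℝ) ∈ boundedStates S C :=
  ⟨map_add f, fun r x => by simp, hS, h1, hC⟩

theorem isCompact_boundedStates (S : Set A) (C : ℝ) : IsCompact (boundedStates S C) := by
  have hcl : IsClosed (boundedStates S C) := by
    simp only [boundedStates, Set.ofPred_and, Set.ofPred_forall]
    refine .inter ?_ (.inter ?_ (.inter ?_ (.inter ?_ ?_)))
    · exact isClosed_iInter fun x => isClosed_iInter fun y =>
        isClosed_eq (by fun_prop) (by fun_prop)
    · exact isClosed_iInter fun r => isClosed_iInter fun y =>
        isClosed_eq (by fun_prop) (by fun_prop)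
    · exact isClosed_iInter fun x => isClosed_iInter fun _ =>
        isClosed_le (by fun_prop) (by fun_prop)
    · exact isClosed_eq (by fun_prop) (by fun_prop)
    · exact isClosed_iInter fun x => isClosed_le (by fun_prop) (by fun_prop)
  refine (isCompact_univ_pi fun x : A =>
    isCompact_Icc (a := -(C * ‖x‖)) (b := C * ‖x‖)).of_isClosed_subset hcl ?_
  exact fun f hf x _ => abs_le.1 (hf.2.2.2.2 x)

theorem extreme_boundedStates_mul {d : ℕ} {S : Set A} (hS : IsSumEvenPowersModule d S) {δ : ℝ}
    (hδ0 : 0 < δ)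
    (hδ : ∀ x : A, ‖x‖ < δ → ∀ ε > 0, ∃ y : A, ‖y ^ (2 * d) - (1 + x)‖ < ε)
    {f : A → ℝ} (hf : f ∈ (boundedStates S (1 / δ)).extremePoints ℝ) (x y : A) :
    f (x * y) = f x * f y := by
  have hmem := hf.1
  set g : A →ₗ[ℝ] ℝ := boundedStates.toLinearMap hmem with hg
  have hgf : ∀ x, f x = g x := fun _ => rfl
  have hgS : ∀ s ∈ S, 0 ≤ g s := hmem.2.2.1
  have hg1 : g 1 = 1 := hmem.2.2.2.1
  have hgC : ∀ x, |g x| ≤ 1 / δ * ‖x‖ := hmem.2.2.2.2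
  have twist : ∀ z : A, ‖z‖ < δ → 0 < 1 + g z →
      (fun w => (1 + g z)⁻¹ * g ((1 + z) * w)) ∈ boundedStates S (1 / δ) := by
    intro z hz hpos
    let h : A →ₗ[ℝ] ℝ := (1 + g z)⁻¹ • g ∘ₗ LinearMap.mulLeft ℝ (1 + z)
    have hh : ∀ w, h w = (1 + g z)⁻¹ * g ((1 + z) * w) := fun w => rfl
    have h1 : h 1 = 1 := by
      rw [hh, mul_one, map_add, hg1, inv_mul_cancel₀ hpos.ne']
    have hhS : ∀ s ∈ S, 0 ≤ h s := fun s hs =>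
      mul_nonneg (inv_nonneg.2 hpos.le) (nonneg_one_add_mul hS hδ hgC hgS hz hs)
    have hhC : ∀ w, |h w| ≤ ((1 + g z)⁻¹ * (1 / δ * ‖1 + z‖)) * ‖w‖ := by
      intro w
      rw [hh, abs_mul, abs_of_pos (inv_pos.2 hpos), mul_assoc, mul_assoc]
      refine mul_le_mul_of_nonneg_left ((hgC _).trans ?_) (inv_nonneg.2 hpos.le)
      exact mul_le_mul_of_nonneg_left (norm_mul_le _ _) (by positivity)
    refine linearMap_mem_boundedStates (f := h) hhS h1 fun w => ?_
    simpa [h1] using abs_le_of_nonneg_on_module hS hδ0 hδ hhC hhS w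
  have small : ∀ z : A, ‖z‖ ≤ δ / 2 → ∀ w, g (z * w) = g z * g w := by
    intro z hz w
    have hb : |g z| ≤ 1 / 2 := by
      refine (hgC z).trans ?_
      rw [div_mul_eq_mul_div, one_mul, div_le_iff₀ hδ0]
      linarith
    obtain ⟨hb1, hb2⟩ := abs_le.1 hb
    have hpos : 0 < 1 + g z := by linarith
    have hneg : 0 < 1 + g (-z) := by rw [map_neg]; linarith
    have m1 := twist z (by linarith) hpos
    have m2 := twist (-z) (by rw [norm_neg]; linarith) hneg
    have hseg : f ∈ openSegment ℝ (fun w => (1 + g z)⁻¹ * g ((1 + z) * w))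
        (fun w => (1 + g (-z))⁻¹ * g ((1 + -z) * w)) := by
      refine ⟨(1 + g z) / 2, (1 + g (-z)) / 2, by positivity, by positivity, ?_, ?_⟩
      · rw [map_neg]; ring
      · funext u
        simp only [Pi.add_apply, Pi.smul_apply, smul_eq_mul, hgf]
        have e1 : g ((1 + z) * u) = g u + g (z * u) := by rw [add_mul, one_mul, map_add]
        have e2 : g ((1 + -z) * u) = g u - g (z * u) := by
          rw [add_mul, one_mul, neg_mul, map_add, map_neg, sub_eq_add_neg]
        rw [e1, e2]
        field_simp
        ring
    have heq := congrFun (hf.2 m1 m2 hseg) w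
    simp only [hgf] at heq
    rw [inv_mul_eq_iff_eq_mul₀ hpos.ne', add_mul, one_mul, map_add] at heq
    linarith
  set t : ℝ := δ / 2 / (‖x‖ + 1) with ht
  have ht0 : 0 < t := by positivity
  have h := small (t • x) (by
    rw [norm_smul, Real.norm_of_nonneg ht0.le, ht, div_mul_eq_mul_div,
      div_le_iff₀ (by positivity)]
    nlinarith [norm_nonneg x]) y
  rw [smul_mul_assoc, map_smul, map_smul, smul_eq_mul, smul_eq_mul, mul_assoc] at h
  exact mul_left_cancel₀ ht0.ne' h

/-- A bounded functional that is nonnegative on a module and negative at `a` can be replaced by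
a bounded character with the same properties. -/
theorem exists_bounded_character_neg {d : ℕ} (hd : 1 ≤ d) {S : Set A}
    (hS : IsSumEvenPowersModule d S) {f : A →ₗ[ℝ] ℝ} {C : ℝ} (hf : ∀ x, |f x| ≤ C * ‖x‖)
    (hfS : ∀ s ∈ S, 0 ≤ f s) {a : A} (ha : f a < 0) :
    ∃ α : A →ₐ[ℝ] ℝ, (∀ s ∈ S, 0 ≤ α s) ∧ α a < 0 ∧ ∃ D, ∀ x, |α x| ≤ D * ‖x‖ := by
  obtain ⟨δ, hδ0, hδ⟩ := exists_pow_near_one_add A (2 * d) (by omega)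
  have hf1 : 0 < f 1 := by
    refine lt_of_le_of_ne (hfS 1 hS.one_mem) fun h => ?_
    have := abs_le_of_nonneg_on_module hS hδ0 hδ hf hfS a
    rw [← h, zero_div, zero_mul] at this
    exact ha.ne (abs_nonpos_iff.1 this)
  set K := boundedStates S (1 / δ)
  have hne : ((f 1)⁻¹ • f : A →ₗ[ℝ] ℝ) ∈ (fun g : A →ₗ[ℝ] ℝ => (g : A → ℝ)) ⁻¹' K := by
    refine linearMap_mem_boundedStates (fun s hs => ?_) ?_ fun x => ?_
    · exact mul_nonneg (inv_nonneg.2 hf1.le) (hfS s hs)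
    · exact inv_mul_cancel₀ hf1.ne'
    · have := abs_le_of_nonneg_on_module hS hδ0 hδ hf hfS x
      rw [LinearMap.smul_apply, smul_eq_mul, abs_mul, abs_of_pos (inv_pos.2 hf1),
        inv_mul_le_iff₀ hf1]
      exact this.trans_eq (by ring)
  have hKc : IsCompact K := isCompact_boundedStates S _
  let ev : StrongDual ℝ (A → ℝ) := -ContinuousLinearMap.proj a
  obtain ⟨m, hmK, hmin⟩ := hKc.exists_isMaxOn ⟨_, hne⟩ ev.continuous.continuousOn
  have hexp : IsExposed ℝ K (ev.toExposed K) := ContinuousLinearMap.toExposed.isExposed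
  obtain ⟨e, he⟩ := (hexp.isCompact hKc).extremePoints_nonempty ⟨m, hmK, hmin⟩
  have heK : e ∈ K.extremePoints ℝ := hexp.isExtreme.extremePoints_subset_extremePoints he
  have hea : e a < 0 := by
    have h1 := he.1.2 _ hne
    have h2 : (f 1)⁻¹ * f a < 0 := mul_neg_of_pos_of_neg (inv_pos.2 hf1) ha
    have h3 : -((f 1)⁻¹ * f a) ≤ -e a := h1
    linarith
  exact ⟨AlgHom.ofLinearMap (boundedStates.toLinearMap heK.1) heK.1.2.2.2.1
    (extreme_boundedStates_mul hS hδ0 hδ heK), heK.1.2.2.1, hea, 1 / δ, heK.1.2.2.2.2⟩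

end Functionals

section LMC

open scoped Pointwise

variable {A : Type*} [CommRing A] [Algebra ℝ A]

theorem Seminorm.exists_character_neg {d : ℕ} (hd : 1 ≤ d) {S : Set A}
    (hS : IsSumEvenPowersModule d S) (p : Seminorm ℝ A) (hp : ∀ x y, p (x * y) ≤ p x * p y)
    {f : A →ₗ[ℝ] ℝ} (hf : ∀ x, |f x| ≤ p x) (hfS : ∀ s ∈ S, 0 ≤ f s) {a : A} (ha : f a < 0) :
    ∃ α : A →ₐ[ℝ] ℝ, (∀ s ∈ S, 0 ≤ α s) ∧ α a < 0 ∧ ∃ D, ∀ x, |α x| ≤ D * p x := by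
  let : SeminormedCommRing A :=
    { p.toAddGroupSeminorm.toSeminormedAddCommGroup, ‹CommRing A› with
      norm_mul_le := hp }
  let : NormedAlgebra ℝ A :=
    { ‹Algebra ℝ A› with norm_smul_le := fun r x => (map_smul_eq_mul p r x).le }
  exact exists_bounded_character_neg hd hS (C := 1) (fun x => by rw [one_mul]; exact hf x) hfS ha

theorem mul_mem_absConvexHull {V : Set A} (hV : ∀ x ∈ V, ∀ y ∈ V, x * y ∈ V) {x y : A}
    (hx : x ∈ absConvexHull ℝ V) (hy : y ∈ absConvexHull ℝ V) : x * y ∈ absConvexHull ℝ V := by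
  have hac : ∀ z : A, AbsConvex ℝ (LinearMap.mulLeft ℝ z ⁻¹' absConvexHull ℝ V) := fun z =>
    ⟨fun r hr => by
      rintro _ ⟨w, hw, rfl⟩
      have := (balanced_absConvexHull (𝕜 := ℝ) (s := V)).smul_mem hr hw
      simpa using this,
     convex_absConvexHull.linear_preimage _⟩
  have h1 : ∀ z ∈ V, ∀ w ∈ absConvexHull ℝ V, z * w ∈ absConvexHull ℝ V := fun z hz w hw =>
    absConvexHull_min (t := LinearMap.mulLeft ℝ z ⁻¹' absConvexHull ℝ V)
      (fun v hv => subset_absConvexHull (hV z hz v hv)) (hac z) hw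
  have h2 := absConvexHull_min (t := LinearMap.mulLeft ℝ y ⁻¹' absConvexHull ℝ V)
      (fun v hv => by
        change y * v ∈ absConvexHull ℝ V
        rw [mul_comm]
        exact h1 v hv y hy) (hac y) hx
  rw [mul_comm]
  exact h2

theorem gauge_mul_le {V : Set A} (hV : ∀ x ∈ V, ∀ y ∈ V, x * y ∈ V) (habs : Absorbent ℝ V)
    (x y : A) : gauge V (x * y) ≤ gauge V x * gauge V y := by
  have key : ∀ r > gauge V x, ∀ t > gauge V y, gauge V (x * y) ≤ r * t := by
    intro r hr t ht
    obtain ⟨a, ha0, har, u, hu, rfl⟩ := exists_lt_of_gauge_lt habs hr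
    obtain ⟨b, hb0, hbt, v, hv, rfl⟩ := exists_lt_of_gauge_lt habs ht
    have h : a • u * b • v ∈ (a * b) • V :=
      ⟨u * v, hV u hu v hv, (smul_mul_smul_comm a u b v).symm⟩
    exact (gauge_le_of_mem (by positivity) h).trans
      (mul_le_mul har.le hbt.le hb0.le (ha0.trans har).le)
  have lim : ∀ c, Filter.Tendsto (fun t : ℝ => t) (𝓝[>] c) (𝓝 c) := fun c => nhdsWithin_le_nhds
  refine ge_of_tendsto ((lim (gauge V x)).mul_const _)
    (Filter.eventually_of_mem self_mem_nhdsWithin fun r hr => ?_)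
  exact ge_of_tendsto ((lim (gauge V y)).const_mul r)
    (Filter.eventually_of_mem self_mem_nhdsWithin fun t ht => key r hr t ht)

theorem IsSumEvenPowersModule.smul_mem {d : ℕ} (hd : 1 ≤ d) {S : Set A}
    (hS : IsSumEvenPowersModule d S) {r : ℝ} (hr : 0 ≤ r) {s : A} (hs : s ∈ S) : r • s ∈ S := by
  have h := hS.pow_mul_mem (algebraMap ℝ A (r ^ ((2 * d : ℕ) : ℝ)⁻¹)) s hs
  rwa [← map_pow, Real.rpow_inv_natCast_pow hr (by omega), ← Algebra.smul_def] at h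

theorem IsSumEvenPowersModule.convex {d : ℕ} (hd : 1 ≤ d) {S : Set A}
    (hS : IsSumEvenPowersModule d S) : Convex ℝ S :=
  fun _ hx _ hy _ _ ha hb _ => hS.add_mem _ (hS.smul_mem hd ha hx) _ (hS.smul_mem hd hb hy)

theorem isSumEvenPowersModule_sumEvenPowers (A : Type*) [CommRing A] (d : ℕ) :
    IsSumEvenPowersModule d (sumEvenPowers A d) where
  one_mem := ⟨1, fun _ => 1, by simp⟩
  add_mem := by
    rintro _ ⟨m, f, rfl⟩ _ ⟨n, g, rfl⟩
    exact ⟨m + n, Fin.append f g, by simp [Fin.sum_univ_add]⟩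
  pow_mul_mem := by
    rintro a _ ⟨n, f, rfl⟩
    exact ⟨n, fun i => a * f i, by simp [mul_pow, Finset.mul_sum]⟩

theorem nonnegCharacters_sumEvenPowers (A : Type*) [CommRing A] [Algebra ℝ A] (d : ℕ) :
    nonnegCharacters (sumEvenPowers A d) = Set.univ := by
  refine Set.eq_univ_of_forall fun α => ?_
  rintro _ ⟨n, f, rfl⟩
  rw [map_sum]
  exact Finset.sum_nonneg fun i _ => by rw [map_pow, pow_mul]; positivity

variable [TopologicalSpace A]

theorem IsLMC.exists_seminorm (hτ : IsLMC A) (f : StrongDual ℝ A) :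
    ∃ p : Seminorm ℝ A, Continuous p ∧ (∀ x y, p (x * y) ≤ p x * p y) ∧ ∀ x, |f x| ≤ p x := by
  have := hτ.continuousSMul
  have := hτ.isTopologicalAddGroup
  have hU : {x | |f x| ≤ 1} ∈ 𝓝 (0 : A) :=
    Filter.mem_of_superset ((isOpen_lt (continuous_abs.comp f.continuous) continuous_const).mem_nhds
      (by simp : (0 : A) ∈ {x | |f x| < (1 : ℝ)})) fun x hx => by
        have hx' : |f x| < 1 := hx
        exact hx'.le
  obtain ⟨V, hV0, hVU, hVV⟩ := hτ.exists_mset _ hU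
  have hW0 : absConvexHull ℝ V ∈ 𝓝 (0 : A) := Filter.mem_of_superset hV0 subset_absConvexHull
  have hWU : absConvexHull ℝ V ⊆ {x | |f x| ≤ 1} := by
    refine absConvexHull_min hVU ⟨?_, ?_⟩
    · rintro r hr _ ⟨x, hx, rfl⟩
      have hx' : |f x| ≤ 1 := hx
      simpa [abs_mul] using mul_le_one₀ (by simpa using hr) (abs_nonneg _) hx'
    · have : {x : A | |f x| ≤ 1} = (f : A →ₗ[ℝ] ℝ) ⁻¹' Set.Icc (-1) 1 := by
        ext x; simp [abs_le]
      rw [this]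
      exact (convex_Icc _ _).linear_preimage _
  have habs : Absorbent ℝ (absConvexHull ℝ V) := absorbent_nhds_zero hW0
  refine ⟨gaugeSeminorm balanced_absConvexHull convex_absConvexHull habs,
    continuous_gauge convex_absConvexHull hW0,
    gauge_mul_le (fun x hx y hy => mul_mem_absConvexHull hVV hx hy) habs, fun x => ?_⟩
  refine le_of_forall_gt_imp_ge_of_dense fun r hr => ?_
  obtain ⟨b, hb0, hbr, y, hy, rfl⟩ := exists_lt_of_gauge_lt habs hr
  have hy' : |f y| ≤ 1 := hWU hy
  have : |f (b • y)| ≤ b := by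
    rw [map_smul, smul_eq_mul, abs_mul, abs_of_pos hb0]
    nlinarith
  exact this.trans hbr.le

theorem IsLMC.closure_eq_posCone (hτ : IsLMC A) {d : ℕ} (hd : 1 ≤ d) {S : Set A}
    (hS : IsSumEvenPowersModule d S) :
    closure S = posCone (nonnegCharacters S ∩ gelfandSpectrum A) := by
  have := hτ.continuousSMul
  have := hτ.isTopologicalAddGroup
  have := hτ.locallyConvexSpace
  refine Set.Subset.antisymm ?_ fun a ha => ?_
  · intro a ha α hα
    exact closure_minimal (t := {x | 0 ≤ α x}) hα.1 (isClosed_le continuous_const hα.2) ha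
  by_contra hcl
  obtain ⟨f, u, hfa, hfS⟩ :=
    geometric_hahn_banach_point_closed (hS.convex hd).closure isClosed_closure hcl
  have hS0 : (0 : A) ∈ S := by simpa using hS.smul_mem hd le_rfl hS.one_mem
  have hu : u < 0 := by simpa using hfS 0 (subset_closure hS0)
  have hpos : ∀ s ∈ S, 0 ≤ f s := by
    intro s hs
    by_contra! hneg
    have h := hfS _ (subset_closure
      (hS.smul_mem hd (div_nonneg_of_nonpos hu.le hneg.le) hs))
    rw [map_smul, smul_eq_mul, div_mul_cancel₀ _ hneg.ne] at h
    exact h.false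
  obtain ⟨p, hpc, hpm, hpf⟩ := hτ.exists_seminorm f
  obtain ⟨α, hαS, hαa, D, hD⟩ := p.exists_character_neg hd hS hpm
    (f := (f : A →ₗ[ℝ] ℝ)) hpf hpos (hfa.trans hu)
  have hαc : Continuous α := by
    refine continuous_of_continuousAt_zero α ?_
    rw [ContinuousAt, map_zero]
    refine squeeze_zero_norm hD ?_
    simpa using (hpc.tendsto 0).const_mul D
  exact (ha α ⟨hαS, hαc⟩).not_gt hαa

end LMC

theorem theorem5p5 {A : Type*} [CommRing A] [Algebra ℝ A] [TopologicalSpace A]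
    (hτ : IsLMC A) (d : ℕ) (hd : 1 ≤ d) :
    (∀ S : Set A, IsSumEvenPowersModule d S →
      closure S = posCone (nonnegCharacters S ∩ gelfandSpectrum A)) ∧
    closure (sumEvenPowers A d) = posCone (gelfandSpectrum A) := by
  exact ⟨fun S hS => hτ.closure_eq_posCone hd hS, by
    rw [hτ.closure_eq_posCone hd (isSumEvenPowersModule_sumEvenPowers A d),
      nonnegCharacters_sumEvenPowers, Set.univ_inter]⟩
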